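/- Let $X$ be a Tychonoff space, and let $C_p(X)$ be the set of all continuous functions $X\to\mathbb R$ with the topology of pointwise convergence (the subspace topology from $\mathbb R^X$). Then the following are equivalent: 1. $C_p(X)$ satisfies $(*_1)$; 2. $C_p(X)$ has countable fan tightness; 3. $C_p(X)$ satisfies $(*_1)$ with respect to dense subspaces; 4. $C_p(X)$ has countable fan tightness with respect to dense subspaces; 5. every finite power $X^k$ ($k\ge 1$) is Menger; 6. every finite power $X^k$ ($k\ge 1$) is Scheepers. Here a space $Z$: - satisfies $(*_1)$ if for every finite $F\subseteq Z$ and every sequence $(Y_n)_{n\in\mathbb N}$ of subsets of $Z$ with $F\subseteq\bigcap_n\overline{Y_n}$ there are finite sets $F_n\subseteq Y_n$ $(n\in\mathbb N)$ such that, for every choice of open sets $U_x\ni x$ $(x\in F)$, some $n$ satisfies $U_x\cap F_n\neq\emptyset$ for all $x\in F$; it satisfies $(*_1)$ with respect to dense subspaces if for every finite $F\subseteq Z$ and every sequence $(Y_n)$ of dense subsets of $Z$ there are finite sets $F_n\subseteq Y_n$ with the same property; - has countable fan tightness if for every $z\in Z$ and every sequence $(Y_n)$ of subsets of $Z$ with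 $z\in\bigcap_n\overline{Y_n}$ there are finite sets $F_n\subseteq Y_n$ with $z\in\overline{\bigcup_n F_n}$; it has countable fan tightness with respect to dense subspaces if for every $z\in Z$ and every sequence $(Y_n)$ of dense subsets of $Z$ there are finite sets $F_n\subseteq Y_n$ with $z\in\overline{\bigcup_n F_n}$; - is Menger if for every sequence $(\mathcal U_n)$ of open covers of $Z$ there are finite $\mathcal V_n\subseteq\mathcal U_n$ such that $\bigcup_n\bigcup\mathcal V_n=Z$; - is Scheepers if for every sequence $(\mathcal U_n)$ of open covers of $Z$ there are finite $\mathcal V_n\subseteq\mathcal U_n$ such that every finite subset of $Z$ is contained in $\bigcup\mathcal V_n$ for some $n$. -/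

import Mathlib

namespace SSep

/-- `C_p(X)`: the continuous real-valued functions on `X` with the topology of pointwise
convergence, i.e. the topology inherited from the product `X → ℝ`. -/
abbrev Cp (X : Type*) [TopologicalSpace X] : Type _ := {f : X → ℝ // Continuous f}

/-- Countable fan tightness. -/
def CountableFanTightness (Z : Type*) [TopologicalSpace Z] : Prop :=
  ∀ (z : Z) (Y : ℕ → Set Z), (∀ n, z ∈ closure (Y n)) →
    ∃ F : ℕ → Set Z, (∀ n, (F n).Finite ∧ F n ⊆ Y n) ∧ z ∈ closure (⋃ n, F n)

/-- Countable fan tightness with respect to dense subspaces. -/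
def CountableFanTightnessDense (Z : Type*) [TopologicalSpace Z] : Prop :=
  ∀ (z : Z) (Y : ℕ → Set Z), (∀ n, Dense (Y n)) →
    ∃ F : ℕ → Set Z, (∀ n, (F n).Finite ∧ F n ⊆ Y n) ∧ z ∈ closure (⋃ n, F n)

/-- `U` chooses an open set `U x ∋ x` for each `x ∈ A`; the family `{U x : x ∈ A}` is what is
called a neighbourhood of the set `A`. Values of `U` outside `A` are irrelevant. -/
def IsNbhdFamily {Z : Type*} [TopologicalSpace Z] (A : Set Z) (U : Z → Set Z) : Prop :=
  ∀ x ∈ A, IsOpen (U x) ∧ x ∈ U x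

/-- Property `(*₁)`. -/
def StarOne (Z : Type*) [TopologicalSpace Z] : Prop :=
  ∀ (A : Set Z) (Y : ℕ → Set Z), A.Finite → (A ⊆ ⋂ n, closure (Y n)) →
    ∃ F : ℕ → Set Z, (∀ n, (F n).Finite ∧ F n ⊆ Y n) ∧
      ∀ U : Z → Set Z, IsNbhdFamily A U → ∃ n, ∀ x ∈ A, (U x ∩ F n).Nonempty

/-- Property `(*₁)` with respect to dense subspaces. -/
def StarOneDense (Z : Type*) [TopologicalSpace Z] : Prop :=
  ∀ (A : Set Z) (Y : ℕ → Set Z), A.Finite → (∀ n, Dense (Y n)) →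
    ∃ F : ℕ → Set Z, (∀ n, (F n).Finite ∧ F n ⊆ Y n) ∧
      ∀ U : Z → Set Z, IsNbhdFamily A U → ∃ n, ∀ x ∈ A, (U x ∩ F n).Nonempty

/-- `𝒰` is an open cover of `Z`. -/
def IsOpenCover (Z : Type*) [TopologicalSpace Z] (𝒰 : Set (Set Z)) : Prop :=
  (∀ U ∈ 𝒰, IsOpen U) ∧ ⋃₀ 𝒰 = Set.univ

/-- The Menger property. -/
def Menger (Z : Type*) [TopologicalSpace Z] : Prop :=
  ∀ 𝒰 : ℕ → Set (Set Z), (∀ n, IsOpenCover Z (𝒰 n)) →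
    ∃ 𝒱 : ℕ → Set (Set Z), (∀ n, (𝒱 n).Finite ∧ 𝒱 n ⊆ 𝒰 n) ∧
      (⋃ n, ⋃₀ 𝒱 n) = Set.univ

/-- The Scheepers property: the sets `⋃₀ 𝒱 n` form an `ω`-cover, in the sense that every finite
subset of `Z` is contained in one of them (some `⋃₀ 𝒱 n` may be all of `Z`). -/
def Scheepers (Z : Type*) [TopologicalSpace Z] : Prop :=
  ∀ 𝒰 : ℕ → Set (Set Z), (∀ n, IsOpenCover Z (𝒰 n)) →
    ∃ 𝒱 : ℕ → Set (Set Z), (∀ n, (𝒱 n).Finite ∧ 𝒱 n ⊆ 𝒰 n) ∧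
      ∀ A : Set Z, A.Finite → ∃ n, A ⊆ ⋃₀ 𝒱 n

end SSep

namespace SSep

/-! Open covers of powers of `X` and closures in `Cp X` translate into each other. A basic
neighbourhood in `Cp X` tests finitely many points, that is, one point of a power of `X`. The tuples
on which chosen functions are `1 / (m + 1)`-close to the members of `A` form an open set, and these
sets cover the power when the functions range over `Y n`; so Menger powers give `StarOne`.
Conversely, for an open cover of `X^k`, the functions whose cozero set has its `k`-th power covered
by finitely many members are dense, and one that is near the constant 1 on a tuple forces that tuple
to be covered. Scheepers powers come from Menger ones because a power of `X^k` is again a power of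
`X`. -/

theorem isOpen_setOf_forall_abs_sub_lt {X : Type*} [TopologicalSpace X] (g : Cp X)
    {S : Set X} (hS : S.Finite) (ε : ℝ) :
    IsOpen {f : Cp X | ∀ x ∈ S, |f.1 x - g.1 x| < ε} := by
  have h : {f : Cp X | ∀ x ∈ S, |f.1 x - g.1 x| < ε} =
      ⋂ x ∈ S, {f : Cp X | |f.1 x - g.1 x| < ε} := by
    ext f; simp
  rw [h]
  refine hS.isOpen_biInter fun x _ => isOpen_lt ?_ continuous_const
  have : Continuous fun f : Cp X => f.1 x := (continuous_apply x).comp continuous_subtype_val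
  exact (this.sub continuous_const).abs

theorem exists_forall_abs_sub_lt_imp_mem {X : Type*} [TopologicalSpace X] {U : Set (Cp X)}
    (hU : IsOpen U) {g : Cp X} (hg : g ∈ U) :
    ∃ S : Finset X, ∃ ε : ℝ, 0 < ε ∧
      ∀ f : Cp X, (∀ x ∈ S, |f.1 x - g.1 x| < ε) → f ∈ U := by
  obtain ⟨V, hV, rfl⟩ := isOpen_induced_iff.1 hU
  obtain ⟨S, u, hu, hsub⟩ := isOpen_pi_iff.1 hV g.1 hg
  have hε : ∀ x : S, ∃ ε : ℝ, 0 < ε ∧ Metric.ball (g.1 x) ε ⊆ u x := fun x =>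
    Metric.isOpen_iff.1 (hu x x.2).1 _ (hu x x.2).2
  choose ε hε hball using hε
  obtain ⟨δ, hδ, hle⟩ : ∃ δ : ℝ, 0 < δ ∧ ∀ x : S, δ ≤ ε x := by
    rcases isEmpty_or_nonempty S with h | h
    · exact ⟨1, one_pos, fun x => h.elim x⟩
    · obtain ⟨x, hx⟩ := Finite.exists_min ε
      exact ⟨ε x, hε x, hx⟩
  refine ⟨S, δ, hδ, fun f hf => hsub fun x hx => hball ⟨x, hx⟩ ?_⟩
  rw [Metric.mem_ball, Real.dist_eq]
  exact (hf x hx).trans_le (hle ⟨x, hx⟩)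

/-- The Menger property for indexed covers. -/
theorem Menger.exists_finite_index {Z : Type*} [TopologicalSpace Z] (hZ : Menger Z)
    {ι : Type*} (T : ℕ → Set ι) (V : ι → Set Z) (hV : ∀ i, IsOpen (V i))
    (hcov : ∀ n z, ∃ i ∈ T n, z ∈ V i) :
    ∃ F : ℕ → Set ι, (∀ n, (F n).Finite ∧ F n ⊆ T n) ∧ ∀ z, ∃ n, ∃ i ∈ F n, z ∈ V i := by
  obtain ⟨𝒱, h𝒱, hun⟩ := hZ (fun n => V '' T n) fun n => by
    refine ⟨?_, Set.eq_univ_of_forall fun z => ?_⟩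
    · rintro _ ⟨i, -, rfl⟩
      exact hV i
    · obtain ⟨i, hi, hz⟩ := hcov n z
      exact ⟨V i, ⟨i, hi, rfl⟩, hz⟩
  have h : ∀ n, ∃ F ⊆ T n, F.Finite ∧ V '' F = 𝒱 n := fun n =>
    Set.exists_subset_image_finite_and.1 ⟨𝒱 n, (h𝒱 n).2, (h𝒱 n).1, rfl⟩ |>.imp
      fun F hF => ⟨hF.1, hF.2.1, hF.2.2.symm⟩
  choose F hFT hF hFV using h
  refine ⟨F, fun n => ⟨hF n, hFT n⟩, fun z => ?_⟩
  obtain ⟨n, hn⟩ := Set.mem_iUnion.1 (hun ▸ Set.mem_univ z)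
  rw [← hFV n] at hn
  obtain ⟨_, ⟨i, hi, rfl⟩, hz⟩ := hn
  exact ⟨n, i, hi, hz⟩

theorem Menger.of_homeomorph {Z W : Type*} [TopologicalSpace Z] [TopologicalSpace W]
    (e : Z ≃ₜ W) (hZ : Menger Z) : Menger W := by
  intro 𝒰 h𝒰
  obtain ⟨F, hF, hcov⟩ := hZ.exists_finite_index (ι := {U : Set W // IsOpen U})
    (fun n => {U | U.1 ∈ 𝒰 n}) (fun U => e ⁻¹' U.1) (fun U => U.2.preimage e.continuous)
    fun n z => by
      obtain ⟨U, hU, hz⟩ : e z ∈ ⋃₀ 𝒰 n := (h𝒰 n).2 ▸ Set.mem_univ _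
      exact ⟨⟨U, (h𝒰 n).1 U hU⟩, hU, hz⟩
  refine ⟨fun n => Subtype.val '' F n, fun n => ⟨(hF n).1.image _, ?_⟩,
    Set.eq_univ_of_forall fun w => ?_⟩
  · rintro _ ⟨U, hU, rfl⟩
    exact (hF n).2 hU
  · obtain ⟨n, U, hU, hw⟩ := hcov (e.symm w)
    exact Set.mem_iUnion.2 ⟨n, U.1, ⟨U, hU, rfl⟩, by simpa using hw⟩

theorem Scheepers.menger {Z : Type*} [TopologicalSpace Z] (hZ : Scheepers Z) : Menger Z := by
  intro 𝒰 h𝒰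
  obtain ⟨𝒱, h𝒱, hcov⟩ := hZ 𝒰 h𝒰
  refine ⟨𝒱, h𝒱, Set.eq_univ_of_forall fun z => ?_⟩
  obtain ⟨n, hn⟩ := hcov {z} (Set.finite_singleton z)
  exact Set.mem_iUnion.2 ⟨n, hn rfl⟩

/-- A nonempty finite subset is the range of a point of some power, and boxes of cover members cover
that power. Indexing by `Nat.pair m j` gives each exponent its own infinite subsequence of covers.
-/
theorem scheepers_of_forall_menger_pi {Z : Type*} [TopologicalSpace Z]
    (hZ : ∀ m : ℕ, Menger (Fin (m + 1) → Z)) : Scheepers Z := by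
  intro 𝒰 h𝒰
  have key : ∀ m : ℕ, ∃ F : ℕ → Set (Fin (m + 1) → {U : Set Z // IsOpen U}),
      (∀ j, (F j).Finite ∧ F j ⊆ {W | ∀ i, (W i).1 ∈ 𝒰 (Nat.pair m j)}) ∧
        ∀ p : Fin (m + 1) → Z, ∃ j, ∃ W ∈ F j, p ∈ Set.univ.pi fun i => (W i).1 := fun m =>
    (hZ m).exists_finite_index _ (fun W : Fin (m + 1) → {U : Set Z // IsOpen U} => Set.univ.pi fun i => (W i).1)
      (fun W => isOpen_set_pi Set.finite_univ fun i _ => (W i).2) fun j p => by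
        have h : ∀ i, p i ∈ ⋃₀ 𝒰 (Nat.pair m j) := fun i => (h𝒰 _).2 ▸ Set.mem_univ _
        choose W hW hp using h
        exact ⟨fun i => ⟨W i, (h𝒰 _).1 _ (hW i)⟩, hW, fun i _ => hp i⟩
  choose F hF hcov using key
  let G (q : ℕ × ℕ) : Set (Set Z) := ⋃ W ∈ F q.1 q.2, Set.range fun i => (W i).1
  refine ⟨fun n => G n.unpair,
    fun n => ⟨(hF _ _).1.biUnion fun W _ => Set.finite_range _, ?_⟩, fun A hA => ?_⟩
  · refine Set.iUnion₂_subset fun W hW => ?_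
    rintro _ ⟨i, rfl⟩
    simpa using (hF _ _).2 hW i
  · rcases A.eq_empty_or_nonempty with rfl | hne
    · exact ⟨0, Set.empty_subset _⟩
    · obtain ⟨m, p, rfl⟩ : ∃ m, ∃ p : Fin (m + 1) → Z, Set.range p = A := by
        obtain ⟨m, p, hp⟩ := hA.fin_param
        obtain _ | m := m
        · obtain ⟨a, ha⟩ := hne
          rw [← hp.2] at ha
          exact ha.choose.elim0
        · exact ⟨m, p, hp.2⟩
      obtain ⟨j, W, hW, hp⟩ := hcov m p
      refine ⟨Nat.pair m j, ?_⟩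
      rintro _ ⟨i, rfl⟩
      refine ⟨(W i).1, ?_, hp i trivial⟩
      beta_reduce
      rw [Nat.unpair_pair]
      exact Set.mem_iUnion₂.2 ⟨W, hW, i, rfl⟩

theorem scheepers_pi_of_forall_menger_pi {X : Type*} [TopologicalSpace X]
    (hX : ∀ k : ℕ, 1 ≤ k → Menger (Fin k → X)) {k : ℕ} (hk : 1 ≤ k) :
    Scheepers (Fin k → X) := by
  refine scheepers_of_forall_menger_pi fun m => ?_
  refine (hX ((m + 1) * k) (Nat.mul_pos m.succ_pos hk)).of_homeomorph ?_
  exact (Homeomorph.piCongrLeft (Y := fun _ => X) finProdFinEquiv).symm.trans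
    { toEquiv := Equiv.curry _ _ _
      continuous_toFun := by
        refine continuous_pi fun i => continuous_pi fun j => continuous_apply (i, j)
      continuous_invFun := by
        refine continuous_pi fun ij => ?_
        exact (continuous_apply ij.2).comp (continuous_apply ij.1) }

theorem StarOne.countableFanTightness {Z : Type*} [TopologicalSpace Z] (h : StarOne Z) :
    CountableFanTightness Z := by
  intro z Y hz
  obtain ⟨F, hF, hU⟩ := h {z} Y (Set.finite_singleton z) (by simpa using hz)
  refine ⟨F, hF, mem_closure_iff.2 fun U hUo hzU => ?_⟩
  obtain ⟨n, hn⟩ := hU (fun _ => U) (by rintro _ rfl; exact ⟨hUo, hzU⟩)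
  exact (hn z rfl).mono (Set.inter_subset_inter_right _ (Set.subset_iUnion F n))

theorem StarOneDense.countableFanTightnessDense {Z : Type*} [TopologicalSpace Z]
    (h : StarOneDense Z) : CountableFanTightnessDense Z := by
  intro z Y hz
  obtain ⟨F, hF, hU⟩ := h {z} Y (Set.finite_singleton z) hz
  refine ⟨F, hF, mem_closure_iff.2 fun U hUo hzU => ?_⟩
  obtain ⟨n, hn⟩ := hU (fun _ => U) (by rintro _ rfl; exact ⟨hUo, hzU⟩)
  exact (hn z rfl).mono (Set.inter_subset_inter_right _ (Set.subset_iUnion F n))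

theorem StarOne.starOneDense {Z : Type*} [TopologicalSpace Z] (h : StarOne Z) :
    StarOneDense Z := fun A Y hA hY =>
  h A Y hA fun x _ => Set.mem_iInter.2 fun n => hY n x

theorem CountableFanTightness.dense {Z : Type*} [TopologicalSpace Z]
    (h : CountableFanTightness Z) : CountableFanTightnessDense Z := fun z Y hY =>
  h z Y fun n => hY n z

theorem starOne_of_subsingleton {Z : Type*} [TopologicalSpace Z] [Subsingleton Z] :
    StarOne Z := by
  intro A Y _ hAY
  refine ⟨Y, fun n => ⟨Set.toFinite _, subset_rfl⟩, fun U hU => ⟨0, fun x hx => ?_⟩⟩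
  exact mem_closure_iff.1 (Set.mem_iInter.1 (hAY hx) 0) _ (hU x hx).1 (hU x hx).2

theorem starOne_cp_of_forall_menger_pi {X : Type*} [TopologicalSpace X]
    (hX : ∀ k : ℕ, 1 ≤ k → Menger (Fin k → X)) : StarOne (Cp X) := by
  rcases isEmpty_or_nonempty X with hE | ⟨⟨x₀⟩⟩
  · exact starOne_of_subsingleton
  intro A Y hA hAY
  have := hA.to_subtype
  let V (m : ℕ) (g : A → Cp X) : Set (Fin (m + 1) → X) :=
    {p | ∀ a i, |(g a).1 (p i) - a.1.1 (p i)| < 1 / ((m : ℝ) + 1)}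
  have hV : ∀ m g, IsOpen (V m g) := fun m g => by
    simp only [V, Set.ofPred_forall]
    refine isOpen_iInter_of_finite fun a => isOpen_iInter_of_finite fun i =>
      isOpen_lt ?_ continuous_const
    have h₁ := (g a).2
    have h₂ := a.1.2
    fun_prop
  have key : ∀ m : ℕ, ∃ F : ℕ → Set (A → Cp X),
      (∀ j, (F j).Finite ∧ F j ⊆ {g | ∀ a, g a ∈ Y (Nat.pair m j)}) ∧
        ∀ p, ∃ j, ∃ g ∈ F j, p ∈ V m g := fun m =>
    (hX (m + 1) m.succ_pos).exists_finite_index _ (V m) (hV m) fun j p => by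
      have h : ∀ a : A, ∃ f ∈ Y (Nat.pair m j),
          ∀ x ∈ Set.range p, |f.1 x - a.1.1 x| < 1 / ((m : ℝ) + 1) := fun a => by
        obtain ⟨f, hf, hfY⟩ := mem_closure_iff.1 (Set.mem_iInter.1 (hAY a.2) (Nat.pair m j)) _
          (isOpen_setOf_forall_abs_sub_lt a.1 (Set.finite_range p) (1 / ((m : ℝ) + 1)))
          (fun x _ => by simpa using by positivity)
        exact ⟨f, hfY, hf⟩
      choose g hg hgp using h
      exact ⟨g, hg, fun a i => hgp a _ ⟨i, rfl⟩⟩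
  choose F hF hcov using key
  refine ⟨fun n => ⋃ g ∈ F n.unpair.1 n.unpair.2, Set.range g,
    fun n => ⟨(hF _ _).1.biUnion fun g _ => Set.finite_range _, ?_⟩, fun U hU => ?_⟩
  · refine Set.iUnion₂_subset fun g hg => ?_
    rintro _ ⟨a, rfl⟩
    simpa using (hF _ _).2 hg a
  have hb : ∀ a : A, ∃ S : Finset X, ∃ M : ℕ, ∀ m ≥ M, ∀ f : Cp X,
      (∀ x ∈ S, |f.1 x - a.1.1 x| < 1 / ((m : ℝ) + 1)) → f ∈ U a := fun a => by
    obtain ⟨S, ε, hε, h⟩ := exists_forall_abs_sub_lt_imp_mem (hU a a.2).1 (hU a a.2).2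
    obtain ⟨M, hM⟩ := exists_nat_one_div_lt hε
    exact ⟨S, M, fun m hm f hf => h f fun x hx =>
      (hf x hx).trans ((Nat.one_div_le_one_div hm).trans_lt hM)⟩
  choose S M hSM using hb
  have hfin : (⋃ a, (S a : Set X)).Finite := Set.finite_iUnion fun a => (S a).finite_toSet
  obtain ⟨B, hB⟩ := (Set.finite_range M).bddAbove
  obtain ⟨k, q, -, hq⟩ := hfin.fin_param
  -- The single parameter `max k B` is both an exponent large enough to list all test points, padded
  -- by `x₀`, and an index beyond every threshold `M a`.
  let p : Fin (max k B + 1) → X := fun i => if h : (i : ℕ) < k then q ⟨i, h⟩ else x₀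
  have hp : ∀ a, ∀ x ∈ S a, ∃ i, p i = x := fun a x hx => by
    obtain ⟨i, rfl⟩ : x ∈ Set.range q := hq ▸ Set.mem_iUnion.2 ⟨a, hx⟩
    refine ⟨⟨i, by have := i.2; omega⟩, ?_⟩
    simp [p]
  obtain ⟨j, g, hg, hpg⟩ := hcov (max k B) p
  refine ⟨Nat.pair (max k B) j, fun a ha => ⟨g ⟨a, ha⟩, ?_, ?_⟩⟩
  · refine hSM ⟨a, ha⟩ (max k B) ((hB ⟨_, rfl⟩).trans (le_max_right _ _)) _ fun x hx => ?_
    obtain ⟨i, rfl⟩ := hp _ x hx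
    exact hpg ⟨a, ha⟩ i
  · refine Set.mem_iUnion₂.2 ⟨g, ?_, _, rfl⟩
    simpa using hg

/-- Interpolation at finitely many points by a continuous function supported in prescribed
neighbourhoods of these points. -/
theorem exists_cp_interpolation {X : Type*} [TopologicalSpace X] [T35Space X] (S : Finset X)
    (N : X → Set X) (hN : ∀ x ∈ S, IsOpen (N x) ∧ x ∈ N x) (r : X → ℝ) :
    ∃ f : Cp X, (∀ x ∈ S, f.1 x = r x) ∧ ∀ y, f.1 y ≠ 0 → ∃ x ∈ S, y ∈ N x := by
  classical
  have h : ∀ x : S, ∃ h : X → ℝ, Continuous h ∧ h x = 1 ∧ (∀ y ∉ N x, h y = 0) ∧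
      ∀ y ∈ S, y ≠ x → h y = 0 := fun x => by
    obtain ⟨h, hc, hx, hK⟩ := CompletelyRegularSpace.completely_regular x.1
      ((N x)ᶜ ∪ ↑(S.erase x)) ((hN x x.2).1.isClosed_compl.union (Finset.isClosed _))
      (by simp [(hN x x.2).2])
    refine ⟨fun y => 1 - (h y : ℝ), by fun_prop, by simp [hx], fun y hy => ?_,
      fun y hy hne => ?_⟩
    · simp [hK (Or.inl hy : y ∈ (N x)ᶜ ∪ ↑(S.erase x))]
    · simp [hK (Or.inr (by simp [hy, hne]) : y ∈ (N x)ᶜ ∪ ↑(S.erase x))]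
  choose h hc h1 h0 h0' using h
  refine ⟨⟨fun y => ∑ x : S, r x * h x y, by fun_prop⟩, fun x hx => ?_, fun y hy => ?_⟩
  · change ∑ z : S, r z * h z x = r x
    rw [Finset.sum_eq_single ⟨x, hx⟩]
    · rw [h1 ⟨x, hx⟩, mul_one]
    · intro z _ hz
      rw [h0' z x hx fun he => hz (Subtype.ext he.symm), mul_zero]
    · simp
  · obtain ⟨x, -, hx⟩ := Finset.exists_ne_zero_of_sum_ne_zero hy
    refine ⟨x, x.2, ?_⟩
    by_contra hyN
    exact hx (by rw [h0 x y hyN, mul_zero])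

/-- Near `g` only the values on a finite set `S` matter; interpolate them by a function vanishing
off small neighbourhoods of `S`. Any tuple from its cozero set then lies in a box around one of the
finitely many tuples from `S`. -/
theorem dense_setOf_support_pow_subset {X : Type*} [TopologicalSpace X] [T35Space X] {k : ℕ}
    {𝒰 : Set (Set (Fin k → X))} (h𝒰 : IsOpenCover (Fin k → X) 𝒰) :
    Dense {f : Cp X | ∃ 𝒲 ⊆ 𝒰, 𝒲.Finite ∧
      ∀ p : Fin k → X, (∀ i, f.1 (p i) ≠ 0) → p ∈ ⋃₀ 𝒲} := by
  intro g
  refine mem_closure_iff.2 fun O hO hgO => ?_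
  obtain ⟨S, ε, hε, hS⟩ := exists_forall_abs_sub_lt_imp_mem hO hgO
  have hbox : ∀ p : Fin k → S, ∃ U ∈ 𝒰, ∃ t : Fin k → Set X,
      (∀ i, IsOpen (t i) ∧ (p i).1 ∈ t i) ∧ Set.univ.pi t ⊆ U := fun p => by
    obtain ⟨U, hU, hp⟩ : (fun i => (p i).1) ∈ ⋃₀ 𝒰 := h𝒰.2 ▸ Set.mem_univ _
    obtain ⟨t, ht, hsub⟩ := isOpen_pi_iff'.1 (h𝒰.1 U hU) _ hp
    exact ⟨U, hU, t, ht, hsub⟩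
  choose U hU t ht hsub using hbox
  -- One neighbourhood of `x` that fits every box in which `x` occurs as a coordinate; the
  -- intersection is finite, hence open.
  let N : X → Set X := fun x => ⋂ (p : Fin k → S) (i : Fin k) (_ : (p i).1 = x), t p i
  obtain ⟨f, hfg, hf⟩ := exists_cp_interpolation S N (fun x _ =>
    ⟨isOpen_iInter_of_finite fun p => isOpen_iInter_of_finite fun i =>
      isOpen_iInter_of_finite fun _ => (ht p i).1,
      by simp only [N, Set.mem_iInter]; rintro p i rfl; exact (ht p i).2⟩) g.1
  refine ⟨f, hS f fun x hx => by simpa [hfg x hx] using hε, Set.range U, ?_,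
    Set.finite_range U, fun p hp => ?_⟩
  · rintro _ ⟨p, rfl⟩
    exact hU p
  · choose s hs hsN using fun i => hf (p i) (hp i)
    refine ⟨U fun i => ⟨s i, hs i⟩, ⟨_, rfl⟩, hsub _ fun i _ => ?_⟩
    have := hsN i
    simp only [N, Set.mem_iInter] at this
    exact this (fun i => ⟨s i, hs i⟩) i rfl

theorem CountableFanTightnessDense.menger_pi {X : Type*} [TopologicalSpace X] [T35Space X]
    (h : CountableFanTightnessDense (Cp X)) (k : ℕ) : Menger (Fin k → X) := by
  intro 𝒰 h𝒰
  let one : Cp X := ⟨fun _ => 1, continuous_const⟩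
  obtain ⟨F, hF, hone⟩ := h one _ fun n => dense_setOf_support_pow_subset (h𝒰 n)
  have hW : ∀ n (f : F n), ∃ 𝒲 ⊆ 𝒰 n, 𝒲.Finite ∧
      ∀ p : Fin k → X, (∀ i, f.1.1 (p i) ≠ 0) → p ∈ ⋃₀ 𝒲 := fun n f => (hF n).2 f.2
  choose 𝒲 hsub hfin hcov using hW
  refine ⟨fun n => ⋃ f : F n, 𝒲 n f, fun n => ⟨?_, Set.iUnion_subset (hsub n)⟩,
    Set.eq_univ_of_forall fun p => ?_⟩
  · have := (hF n).1.to_subtype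
    exact Set.finite_iUnion (hfin n)
  -- Within distance less than 1 of the constant 1, `f` cannot vanish at any coordinate of `p`.
  · obtain ⟨f, hf, hfF⟩ := mem_closure_iff.1 hone _
      (isOpen_setOf_forall_abs_sub_lt one (Set.finite_range p) 1) (fun x _ => by simp)
    obtain ⟨n, hn⟩ := Set.mem_iUnion.1 hfF
    obtain ⟨W, hWm, hpW⟩ := hcov n ⟨f, hn⟩ p fun i h0 => by
      have := hf (p i) ⟨i, rfl⟩
      rw [show f.1 (p i) = 0 from h0] at this
      simp [one] at this
    exact Set.mem_iUnion.2 ⟨n, W, Set.mem_iUnion.2 ⟨_, hWm⟩, hpW⟩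

end SSep

theorem mainTheorem7 (X : Type*) [TopologicalSpace X] [T35Space X] :
    List.TFAE [
      SSep.StarOne (SSep.Cp X),
      SSep.CountableFanTightness (SSep.Cp X),
      SSep.StarOneDense (SSep.Cp X),
      SSep.CountableFanTightnessDense (SSep.Cp X),
      ∀ k : ℕ, 1 ≤ k → SSep.Menger (Fin k → X),
      ∀ k : ℕ, 1 ≤ k → SSep.Scheepers (Fin k → X)] := by
  tfae_have 1 → 2 := SSep.StarOne.countableFanTightness
  tfae_have 1 → 3 := SSep.StarOne.starOneDense
  tfae_have 2 → 4 := SSep.CountableFanTightness.dense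
  tfae_have 3 → 4 := SSep.StarOneDense.countableFanTightnessDense
  tfae_have 4 → 5 := fun h k _ => h.menger_pi k
  tfae_have 5 → 6 := fun h _ hk => SSep.scheepers_pi_of_forall_menger_pi h hk
  tfae_have 6 → 5 := fun h k hk => (h k hk).menger
  tfae_have 5 → 1 := SSep.starOne_cp_of_forall_menger_pi
  tfae_finish
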